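/- Let $n\ge 1$ and let $\mathcal P$ be a probability distribution supported on $[0,1]^{n}\times[0,1]$, from which the valuations $(\mathbf b,s)$ of $n$ buyers and of one seller are drawn. Let $\overline b$ be the highest and $\underline b$ the second-highest entry of $\mathbf b$ (counted with multiplicity; $\underline b=0$ if $n=1$). For a reserve price $q\in[0,1]$ let $$\mathsf{GFT}(q)=\mathbb E_{(\mathbf b,s)\sim\mathcal P}\left[(\overline b-s)\,\mathbb I(s\le \max\{q,\underline b\})\,\mathbb I(\overline b\ge q)\right]$$ be the expected gain from trade of the strongly budget balanced (SBB) mechanism with reserve price $q$. Let $T_0,K\ge 1$ be integers and let $\delta>0$ (for $\delta\ge 1$ the probability claim below is void). Draw $T_0$ independent samples $(\mathbf b_t,s_t)\sim\mathcal P$, let $\overline b_t$ be the highest entry of $\mathbf b_t$, and build the grid as follows. Put $p_0=0$ and, for $k=0,\dots,K-1$, let $p_{k+1}$ be the largest $q\in\{\overline b_1,\dots,\overline b_{T_0}\}$ such that $$\left|\{t\in\{1,\dots,T_0\}: p_k<\overline b_t<q\}\right|\le \frac{T_0}{K}$$ (and $p_{k+1}=1$ if there is no such $q$). Let $\mathcal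 B$ be either $\{p_0,p_1,\dots,p_K\}$, or the union of this set with the uniform grid $\{j/K: j=0,1,\dots,K\}$. Then $\mathsf{GFT}$ attains its maximum over $[0,1]$ and, for each of the two choices of $\mathcal B$, with probability at least $1-\delta$ over the samples, $$\max_{q\in[0,1]}\mathsf{GFT}(q)-\max_{q\in\mathcal B}\mathsf{GFT}(q)\le \frac1K+\sqrt{\frac{\ln(2/\delta)}{2T_0}}.$$ -/

import Mathlib

/-- A realization of one round: the valuations of the `n` buyers and the valuation of the seller. -/
abbrev Valuations (n : ℕ) : Type := (Fin n → ℝ) × ℝ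

/-- The highest buyer valuation. -/
noncomputable def highestBid {n : ℕ} (b : Fin n → ℝ) : ℝ := ⨆ i, b i

/-- The second-highest buyer valuation: the highest valuation left after one highest bidder has
been removed, which is the least of the values obtained by removing a single buyer (see
`secondHighestBid_eq`).  With a single buyer it is `0`. -/
noncomputable def secondHighestBid {n : ℕ} (b : Fin n → ℝ) : ℝ :=
  ⨅ i : Fin n, ⨆ j : {j : Fin n // j ≠ i}, b j

/-- Ties are irrelevant: whichever buyer `w` with the highest valuation is declared the winner,
`secondHighestBid b` is the highest valuation among the other buyers. -/
theorem secondHighestBid_eq {n : ℕ} (b : Fin n → ℝ) (w : Fin n) (hw : ∀ j, b j ≤ b w) :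
    secondHighestBid b = ⨆ j : {j : Fin n // j ≠ w}, b j := by
  unfold secondHighestBid
  have : Nonempty (Fin n) := ⟨w⟩
  apply le_antisymm
  · exact ciInf_le (Set.finite_range _).bddBelow w
  · refine le_ciInf fun i => ?_
    rcases isEmpty_or_nonempty {j : Fin n // j ≠ w} with he | hne
    · have hi : i = w := by
        by_contra h
        exact he.false ⟨i, h⟩
      subst hi
      exact le_rfl
    · refine ciSup_le fun j => ?_
      by_cases hji : (j : Fin n) = i
      · have hwi : w ≠ i := fun h => j.2 (hji.trans h.symm)
        exact (hw j).trans
          (le_ciSup (f := fun k : {k : Fin n // k ≠ i} => b k) (Set.finite_range _).bddAbove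
            ⟨w, hwi⟩)
      · exact le_ciSup (f := fun k : {k : Fin n // k ≠ i} => b k) (Set.finite_range _).bddAbove
            ⟨j, hji⟩

/-- The realized gain from trade of seller price `p` and reserve price `q`:
`(b̄ - s) 𝕀(s ≤ p) 𝕀(b̄ ≥ q)`. -/
noncomputable def realizedGFT {n : ℕ} (p q : ℝ) (v : Valuations n) : ℝ :=
  if v.2 ≤ p ∧ q ≤ highestBid v.1 then highestBid v.1 - v.2 else 0

/-- The expected gain from trade of the strongly budget balanced mechanism with reserve price `q`,
in which the seller is offered the price `max {b̲, q}`. -/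
noncomputable def expectedGFT {n : ℕ} (P : MeasureTheory.Measure (Valuations n)) (q : ℝ) : ℝ :=
  ∫ v, realizedGFT (max (secondHighestBid v.1) q) q v ∂P

/-- The number (with multiplicity) of samples lying strictly between `p` and `q`. -/
noncomputable def countBetween {T₀ : ℕ} (β : Fin T₀ → ℝ) (p q : ℝ) : ℕ :=
  (Finset.univ.filter fun t : Fin T₀ => p < β t ∧ β t < q).card

/-- The samples `q` such that at most `T₀ / K` samples lie strictly between `p` and `q`. -/
noncomputable def gridCandidates {T₀ : ℕ} (K : ℕ) (β : Fin T₀ → ℝ) (p : ℝ) : Finset ℝ :=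
  (Finset.univ.image β).filter fun q => (countBetween β p q : ℝ) ≤ (T₀ : ℝ) / (K : ℝ)

/-- The grid point computed after `p`: the largest candidate, and `1` if there is none. -/
noncomputable def nextGridPoint {T₀ : ℕ} (K : ℕ) (β : Fin T₀ → ℝ) (p : ℝ) : ℝ :=
  if h : (gridCandidates K β p).Nonempty then (gridCandidates K β p).max' h else 1

/-- The points `p₀ = 0, p₁, p₂, …` computed from the samples. -/
noncomputable def gridPoint {T₀ : ℕ} (K : ℕ) (β : Fin T₀ → ℝ) : ℕ → ℝ
  | 0 => 0
  | k + 1 => nextGridPoint K β (gridPoint K β k)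

/-- The adaptive grid `{p₀, p₁, …, p_K}` computed from the samples. -/
noncomputable def adaptiveGrid {T₀ : ℕ} (K : ℕ) (β : Fin T₀ → ℝ) : Finset ℝ :=
  (Finset.range (K + 1)).image (gridPoint K β)

/-- The uniform grid `{0, 1/K, 2/K, …, 1}`. -/
noncomputable def uniformGrid (K : ℕ) : Finset ℝ :=
  (Finset.range (K + 1)).image fun j : ℕ => (j : ℝ) / (K : ℝ)

theorem adaptiveGrid_nonempty {T₀ : ℕ} (K : ℕ) (β : Fin T₀ → ℝ) : (adaptiveGrid K β).Nonempty :=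
  Finset.Nonempty.image ⟨0, by simp⟩ _

/-- The best expected gain from trade of a reserve price on the adaptive grid. -/
noncomputable def bestOnAdaptiveGrid {n T₀ : ℕ} (P : MeasureTheory.Measure (Valuations n)) (K : ℕ)
    (β : Fin T₀ → ℝ) : ℝ :=
  (adaptiveGrid K β).sup' (adaptiveGrid_nonempty K β) (expectedGFT P)

/-- The best expected gain from trade of a reserve price on the union of the adaptive grid and the
uniform grid. -/
noncomputable def bestOnAugmentedGrid {n T₀ : ℕ} (P : MeasureTheory.Measure (Valuations n)) (K : ℕ)
    (β : Fin T₀ → ℝ) : ℝ :=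
  (adaptiveGrid K β ∪ uniformGrid K).sup' (adaptiveGrid_nonempty K β).inl (expectedGFT P)

/-! Fix a maximizer `q` and put `c = 1/K + ε`. Raising the reserve price from `q` to `p` also raises
the seller's price, so trade is lost only when the highest bid falls in `[q, p)`: the loss is at
most the probability of that event (`expectedGFT_le_add`).

If the highest bid is at least `q` with probability at most `c`, every grid loses at most `c`.
Otherwise let `r` be the least number for which `[q, r]` has probability at least `c`. If the grid
loses more than `c`, each grid point `p ≥ q` satisfies `r < p`. The first such `p` has at most `T₀ /
K` samples in `[q, p)`, hence in `[q, r]`; if there is no such `p`, no sample reaches `q`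
(`exists_adaptiveGrid_ge`). So failure makes the empirical frequency of `[q, r]` at most `1/K`,
against a probability of at least `1/K + ε`. This interval does not depend on the samples, so a
single one-sided Hoeffding bound suffices, with no uniform convergence over intervals.

The maximizer exists because the gain from trade is upper semicontinuous in the reserve price, a
property that Fatou's lemma carries over to the expectation. -/

open MeasureTheory ProbabilityTheory Filter Topology

/-! ### Gain from trade as a function of the reserve price. -/

section Valuations

variable {n : ℕ}

theorem measurable_highestBid : Measurable (highestBid : (Fin n → ℝ) → ℝ) :=
  Measurable.iSup fun i => measurable_pi_apply i

theorem measurable_secondHighestBid : Measurable (secondHighestBid : (Fin n → ℝ) → ℝ) :=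
  Measurable.iInf fun _ => Measurable.iSup fun j => measurable_pi_apply j.1

theorem measurable_realizedGFT (q : ℝ) :
    Measurable fun v : Valuations n => realizedGFT (max (secondHighestBid v.1) q) q v := by
  have h₁ : Measurable fun v : Valuations n => highestBid v.1 :=
    measurable_highestBid.comp measurable_fst
  have h₂ : Measurable fun v : Valuations n => secondHighestBid v.1 :=
    measurable_secondHighestBid.comp measurable_fst
  have h₃ : Measurable fun v : Valuations n => v.2 := measurable_snd
  refine Measurable.ite ?_ (h₁.sub h₃) measurable_const
  exact (measurableSet_le h₃ (h₂.max measurable_const)).inter (measurableSet_le measurable_const h₁)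

theorem highestBid_mem_Icc (hn : 1 ≤ n) {b : Fin n → ℝ} (hb : ∀ i, b i ∈ Set.Icc (0 : ℝ) 1) :
    highestBid b ∈ Set.Icc (0 : ℝ) 1 := by
  have : Nonempty (Fin n) := ⟨⟨0, hn⟩⟩
  exact ⟨Real.iSup_nonneg fun i => (hb i).1, ciSup_le fun i => (hb i).2⟩

theorem secondHighestBid_le_highestBid (hn : 1 ≤ n) {b : Fin n → ℝ}
    (hb : ∀ i, b i ∈ Set.Icc (0 : ℝ) 1) : secondHighestBid b ≤ highestBid b := by
  let i₀ : Fin n := ⟨0, hn⟩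
  refine (ciInf_le (Set.finite_range _).bddBelow i₀).trans ?_
  -- For `n = 1` this is an empty supremum, equal to `0`; hence the nonnegativity of the highest bid
  -- is needed.
  refine Real.iSup_le (fun j => ?_) (highestBid_mem_Icc hn hb).1
  exact le_ciSup (Set.finite_range b).bddAbove j.1

theorem realizedGFT_mem_Icc (hn : 1 ≤ n) {v : Valuations n}
    (hv : (∀ i, v.1 i ∈ Set.Icc (0 : ℝ) 1) ∧ v.2 ∈ Set.Icc (0 : ℝ) 1) (q : ℝ) :
    realizedGFT (max (secondHighestBid v.1) q) q v ∈ Set.Icc (0 : ℝ) 1 := by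
  have h₁ := highestBid_mem_Icc hn hv.1
  have h₂ := secondHighestBid_le_highestBid hn hv.1
  have h₃ := hv.2
  unfold realizedGFT
  split_ifs with h
  · exact ⟨sub_nonneg.2 (h.1.trans (max_le h₂ h.2)), by linarith [h₁.2, h₃.1]⟩
  · simp

/-- At fixed valuations the gain from trade is upper semicontinuous in the reserve price. -/
theorem eventually_realizedGFT_le (hn : 1 ≤ n) {v : Valuations n}
    (hv : (∀ i, v.1 i ∈ Set.Icc (0 : ℝ) 1) ∧ v.2 ∈ Set.Icc (0 : ℝ) 1) (q : ℝ) :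
    ∀ᶠ p in 𝓝 q, realizedGFT (max (secondHighestBid v.1) p) p v
      ≤ realizedGFT (max (secondHighestBid v.1) q) q v := by
  by_cases h : v.2 ≤ max (secondHighestBid v.1) q ∧ q ≤ highestBid v.1
  · have h₀ : 0 ≤ highestBid v.1 - v.2 :=
      sub_nonneg.2 (h.1.trans (max_le (secondHighestBid_le_highestBid hn hv.1) h.2))
    refine Eventually.of_forall fun p => ?_
    rw [realizedGFT, realizedGFT, if_pos h]
    split_ifs
    · exact le_rfl
    · exact h₀
  -- The reserve prices that allow trade form a closed set, so absence of trade persists near `q`.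
  · have hc : IsClosed {p | v.2 ≤ max (secondHighestBid v.1) p ∧ p ≤ highestBid v.1} :=
      (isClosed_le continuous_const (continuous_const.max continuous_id)).inter
        (isClosed_le continuous_id continuous_const)
    filter_upwards [hc.isOpen_compl.mem_nhds h] with p hp
    have hp' : ¬(v.2 ≤ max (secondHighestBid v.1) p ∧ p ≤ highestBid v.1) := hp
    rw [realizedGFT, realizedGFT, if_neg h, if_neg hp']

/-- Raising the reserve price from `q` to `p` costs at most `1`, and only if the highest bid lies
in `[q, p)`. -/
theorem realizedGFT_le_add_indicator (hn : 1 ≤ n) {v : Valuations n}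
    (hv : (∀ i, v.1 i ∈ Set.Icc (0 : ℝ) 1) ∧ v.2 ∈ Set.Icc (0 : ℝ) 1) {q p : ℝ} (hqp : q ≤ p) :
    realizedGFT (max (secondHighestBid v.1) q) q v
      ≤ realizedGFT (max (secondHighestBid v.1) p) p v
        + {v : Valuations n | q ≤ highestBid v.1 ∧ highestBid v.1 < p}.indicator 1 v := by
  have hp := (realizedGFT_mem_Icc hn hv p).1
  have hq := (realizedGFT_mem_Icc hn hv q).2
  by_cases h : v ∈ {v : Valuations n | q ≤ highestBid v.1 ∧ highestBid v.1 < p}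
  · rw [Set.indicator_of_mem h, Pi.one_apply]
    linarith
  · rw [Set.indicator_of_notMem h, add_zero]
    by_cases hT : v.2 ≤ max (secondHighestBid v.1) q ∧ q ≤ highestBid v.1
    · have hT' : v.2 ≤ max (secondHighestBid v.1) p ∧ p ≤ highestBid v.1 :=
        ⟨hT.1.trans (max_le_max le_rfl hqp), not_lt.1 fun h' => h ⟨hT.2, h'⟩⟩
      rw [realizedGFT, realizedGFT, if_pos hT, if_pos hT']
    · rw [realizedGFT, if_neg hT]
      exact hp

theorem measurableSet_highestBid_mem {s : Set ℝ} (hs : MeasurableSet s) :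
    MeasurableSet {v : Valuations n | highestBid v.1 ∈ s} :=
  (measurable_highestBid.comp measurable_fst) hs

variable {P : Measure (Valuations n)}

theorem expectedGFT_nonneg (hn : 1 ≤ n)
    (hP : ∀ᵐ v ∂P, (∀ i, v.1 i ∈ Set.Icc (0 : ℝ) 1) ∧ v.2 ∈ Set.Icc (0 : ℝ) 1) (q : ℝ) :
    0 ≤ expectedGFT P q :=
  integral_nonneg_of_ae (hP.mono fun _ hv => (realizedGFT_mem_Icc hn hv q).1)

variable [IsProbabilityMeasure P]

theorem integrable_realizedGFT (hn : 1 ≤ n)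
    (hP : ∀ᵐ v ∂P, (∀ i, v.1 i ∈ Set.Icc (0 : ℝ) 1) ∧ v.2 ∈ Set.Icc (0 : ℝ) 1) (q : ℝ) :
    Integrable (fun v => realizedGFT (max (secondHighestBid v.1) q) q v) P :=
  Integrable.of_mem_Icc 0 1 (measurable_realizedGFT q).aemeasurable
    (hP.mono fun _ hv => realizedGFT_mem_Icc hn hv q)

theorem expectedGFT_le_add (hn : 1 ≤ n)
    (hP : ∀ᵐ v ∂P, (∀ i, v.1 i ∈ Set.Icc (0 : ℝ) 1) ∧ v.2 ∈ Set.Icc (0 : ℝ) 1) {q p : ℝ}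
    (hqp : q ≤ p) :
    expectedGFT P q ≤ expectedGFT P p + P.real {v | q ≤ highestBid v.1 ∧ highestBid v.1 < p} := by
  have hm : MeasurableSet {v : Valuations n | q ≤ highestBid v.1 ∧ highestBid v.1 < p} :=
    measurableSet_highestBid_mem measurableSet_Ico
  have hi : Integrable ({v : Valuations n | q ≤ highestBid v.1 ∧ highestBid v.1 < p}.indicator
      (1 : Valuations n → ℝ)) P := (integrable_const (1 : ℝ)).indicator hm
  rw [← integral_indicator_one hm, expectedGFT, expectedGFT,
    ← integral_add (integrable_realizedGFT hn hP p) hi]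
  exact integral_mono_ae (integrable_realizedGFT hn hP q)
    ((integrable_realizedGFT hn hP p).add hi)
    (hP.mono fun _ hv => realizedGFT_le_add_indicator hn hv hqp)

theorem expectedGFT_le_measureReal (hn : 1 ≤ n)
    (hP : ∀ᵐ v ∂P, (∀ i, v.1 i ∈ Set.Icc (0 : ℝ) 1) ∧ v.2 ∈ Set.Icc (0 : ℝ) 1) (q : ℝ) :
    expectedGFT P q ≤ P.real {v | q ≤ highestBid v.1} := by
  have hm : MeasurableSet {v : Valuations n | q ≤ highestBid v.1} :=
    measurableSet_highestBid_mem measurableSet_Ici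
  rw [← integral_indicator_one hm, expectedGFT]
  refine integral_mono_ae (integrable_realizedGFT hn hP q)
    ((integrable_const (1 : ℝ)).indicator hm) (hP.mono fun v hv => ?_)
  by_cases h : q ≤ highestBid v.1
  · simpa [Set.indicator_of_mem (s := {v : Valuations n | q ≤ highestBid v.1}) h]
      using (realizedGFT_mem_Icc hn hv q).2
  · simp [realizedGFT, h]

/-- The expected gain from trade attains its maximum over `[0, 1]`. -/
theorem exists_isMaxOn_expectedGFT (hn : 1 ≤ n)
    (hP : ∀ᵐ v ∂P, (∀ i, v.1 i ∈ Set.Icc (0 : ℝ) 1) ∧ v.2 ∈ Set.Icc (0 : ℝ) 1) :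
    ∃ q ∈ Set.Icc (0 : ℝ) 1, IsMaxOn (expectedGFT P) (Set.Icc (0 : ℝ) 1) q := by
  let f : ℝ → Valuations n → ℝ := fun q v => realizedGFT (max (secondHighestBid v.1) q) q v
  -- The complement `1 - f` is nonnegative and lower semicontinuous in `q` for almost every `v`,
  -- which is the form Fatou's lemma takes.
  let L : ℝ → ENNReal := fun q => ∫⁻ v, ENNReal.ofReal (1 - f q v) ∂P
  have hfm (q : ℝ) : Measurable fun v => ENNReal.ofReal (1 - f q v) :=
    (measurable_const.sub (measurable_realizedGFT q)).ennreal_ofReal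
  have hL : LowerSemicontinuous L := by
    refine lowerSemicontinuous_iff_le_liminf.2 fun q => ?_
    refine le_trans (lintegral_mono_ae (hP.mono fun v hv => ?_)) (lintegral_liminf_le hfm)
    refine le_liminf_of_le (by isBoundedDefault) ?_
    filter_upwards [eventually_realizedGFT_le hn hv q] with p hp
    exact ENNReal.ofReal_le_ofReal (sub_le_sub_left hp 1)
  obtain ⟨q, hq, hmin⟩ := (hL.lowerSemicontinuousOn _).exists_isMinOn
    (Set.nonempty_Icc.2 (zero_le_one' ℝ)) isCompact_Icc
  have hE (p : ℝ) : ENNReal.ofReal (1 - expectedGFT P p) = L p := by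
    have hi : Integrable (fun v => 1 - f p v) P :=
      (integrable_const (1 : ℝ)).sub (integrable_realizedGFT hn hP p)
    change _ = ∫⁻ v, ENNReal.ofReal (1 - f p v) ∂P
    rw [← ofReal_integral_eq_lintegral_ofReal hi
      (hP.mono fun v hv => sub_nonneg.2 (realizedGFT_mem_Icc hn hv p).2),
      integral_sub (integrable_const _) (integrable_realizedGFT hn hP p)]
    simp [expectedGFT]
  have hle (p : ℝ) : expectedGFT P p ≤ 1 :=
    (expectedGFT_le_measureReal hn hP p).trans measureReal_le_one
  refine ⟨q, hq, fun p hp => ?_⟩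
  have h : L q ≤ L p := hmin hp
  rw [← hE, ← hE, ENNReal.ofReal_le_ofReal_iff (sub_nonneg.2 (hle p))] at h
  exact (sub_le_sub_iff_left 1).1 h

end Valuations

/-! ### Counting samples between grid points. -/

section Grid

variable {T₀ K : ℕ} {β : Fin T₀ → ℝ}

/-- The smallest sample has no sample below it and always qualifies, so the default value `1` is
never used. -/
theorem gridCandidates_nonempty (hT₀ : 1 ≤ T₀) (K : ℕ) (β : Fin T₀ → ℝ) (p : ℝ) :
    (gridCandidates K β p).Nonempty := by
  have : Nonempty (Fin T₀) := ⟨⟨0, hT₀⟩⟩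
  obtain ⟨t, ht⟩ := Finite.exists_min β
  refine ⟨β t, Finset.mem_filter.2 ⟨Finset.mem_image_of_mem β (Finset.mem_univ t), ?_⟩⟩
  have : countBetween β p (β t) = 0 :=
    Finset.card_eq_zero.2 (Finset.filter_eq_empty_iff.2 fun s _ h => (ht s).not_gt h.2)
  rw [this, Nat.cast_zero]
  positivity

theorem nextGridPoint_mem (hT₀ : 1 ≤ T₀) (K : ℕ) (β : Fin T₀ → ℝ) (p : ℝ) :
    nextGridPoint K β p ∈ gridCandidates K β p := by
  rw [nextGridPoint, dif_pos (gridCandidates_nonempty hT₀ K β p)]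
  exact Finset.max'_mem _ _

theorem le_nextGridPoint {p q : ℝ} (hq : q ∈ gridCandidates K β p) : q ≤ nextGridPoint K β p := by
  rw [nextGridPoint, dif_pos ⟨q, hq⟩]
  exact Finset.le_max' _ _ hq

/-- At most `T₀ / K` samples lie strictly between a grid point and the next one. -/
theorem countBetween_nextGridPoint_le (hT₀ : 1 ≤ T₀) (K : ℕ) (β : Fin T₀ → ℝ) (p : ℝ) :
    (countBetween β p (nextGridPoint K β p) : ℝ) ≤ (T₀ : ℝ) / (K : ℝ) :=
  (Finset.mem_filter.1 (nextGridPoint_mem hT₀ K β p)).2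

/-- Each grid point is at least as large as all samples, or at least `T₀ / K` more samples lie
weakly below it than below the preceding one. -/
theorem le_gridPoint_or_card_le (K : ℕ) (β : Fin T₀ → ℝ) (k : ℕ) :
    (∀ t, β t ≤ gridPoint K β k) ∨
      (k : ℝ) * ((T₀ : ℝ) / (K : ℝ))
        ≤ ((Finset.univ.filter fun t => β t ≤ gridPoint K β k).card : ℝ) := by
  induction k with
  | zero => right; simp
  | succ k ih =>
    rw [or_iff_not_imp_left]
    intro hne
    push Not at hne
    obtain ⟨t₀, ht₀⟩ := hne
    obtain ⟨t, ht, hmin⟩ := Finset.exists_min_image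
      (Finset.univ.filter fun t => gridPoint K β (k + 1) < β t) β
      ⟨t₀, Finset.mem_filter.2 ⟨Finset.mem_univ _, ht₀⟩⟩
    have ht' : gridPoint K β (k + 1) < β t := (Finset.mem_filter.1 ht).2
    -- `β t` is the smallest sample above the new grid point, which is the largest candidate; so `β
    -- t` fails the count. The samples counted lie below `β t`, hence weakly below the new grid
    -- point.
    have hgt : (T₀ : ℝ) / (K : ℝ) < (countBetween β (gridPoint K β k) (β t) : ℝ) := by
      by_contra! hle
      exact ht'.not_ge (le_nextGridPoint (Finset.mem_filter.2
        ⟨Finset.mem_image_of_mem β (Finset.mem_univ t), hle⟩))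
    have hpos : 0 < countBetween β (gridPoint K β k) (β t) := by
      have : (0 : ℝ) ≤ (T₀ : ℝ) / (K : ℝ) := by positivity
      exact_mod_cast this.trans_lt hgt
    obtain ⟨s, hs⟩ := Finset.card_pos.1 hpos
    have hkt : gridPoint K β k < β t :=
      (Finset.mem_filter.1 hs).2.1.trans (Finset.mem_filter.1 hs).2.2
    have hk : (k : ℝ) * ((T₀ : ℝ) / (K : ℝ))
        ≤ ((Finset.univ.filter fun t => β t ≤ gridPoint K β k).card : ℝ) :=
      ih.resolve_left fun h => (h t).not_gt hkt
    have hdisj : Disjoint (Finset.univ.filter fun t => β t ≤ gridPoint K β k)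
        (Finset.univ.filter fun s => gridPoint K β k < β s ∧ β s < β t) :=
      Finset.disjoint_filter.2 fun s _ h₁ h₂ => h₁.not_gt h₂.1
    have hsub : (Finset.univ.filter fun t => β t ≤ gridPoint K β k) ∪
        (Finset.univ.filter fun s => gridPoint K β k < β s ∧ β s < β t) ⊆
        Finset.univ.filter fun s => β s ≤ gridPoint K β (k + 1) := by
      intro s hs
      have hst : β s < β t := by
        rcases Finset.mem_union.1 hs with h | h
        · exact (Finset.mem_filter.1 h).2.trans_lt hkt
        · exact (Finset.mem_filter.1 h).2.2
      refine Finset.mem_filter.2 ⟨Finset.mem_univ _, not_lt.1 fun h => ?_⟩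
      exact hst.not_ge (hmin s (Finset.mem_filter.2 ⟨Finset.mem_univ _, h⟩))
    have hcard := Finset.card_le_card hsub
    rw [Finset.card_union_of_disjoint hdisj] at hcard
    have hcard' : ((Finset.univ.filter fun t => β t ≤ gridPoint K β k).card : ℝ)
        + (countBetween β (gridPoint K β k) (β t) : ℝ)
        ≤ ((Finset.univ.filter fun s => β s ≤ gridPoint K β (k + 1)).card : ℝ) := by
      exact_mod_cast hcard
    push_cast
    linarith

/-- The last grid point is at least as large as all samples. -/
theorem le_gridPoint_self (hK : 1 ≤ K) (β : Fin T₀ → ℝ) (t : Fin T₀) : β t ≤ gridPoint K β K := by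
  rcases le_gridPoint_or_card_le K β K with h | h
  · exact h t
  · have hK' : (K : ℝ) ≠ 0 := by positivity
    rw [mul_div_cancel₀ _ hK', Nat.cast_le] at h
    have huniv := Finset.eq_univ_of_card _ (le_antisymm (Finset.card_le_univ _)
      (by rwa [Fintype.card_fin]))
    have ht : t ∈ Finset.univ.filter fun t => β t ≤ gridPoint K β K := by
      rw [huniv]
      exact Finset.mem_univ t
    exact (Finset.mem_filter.1 ht).2

/-- Above a price `q` either there is no sample, or there is a grid point with at most `T₀ / K`
samples in between. -/
theorem exists_adaptiveGrid_ge (hT₀ : 1 ≤ T₀) (hK : 1 ≤ K) (β : Fin T₀ → ℝ) {q : ℝ} (hq : 0 ≤ q) :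
    (∀ t, β t < q) ∨ ∃ p ∈ adaptiveGrid K β, q ≤ p ∧
      ((Finset.univ.filter fun t => q ≤ β t ∧ β t < p).card : ℝ) ≤ (T₀ : ℝ) / (K : ℝ) := by
  by_cases hex : ∃ k, k ≤ K ∧ q ≤ gridPoint K β k
  · right
    classical
    -- Take the first index whose grid point reaches `q`: its predecessor lies below `q`, so no
    -- monotonicity of the grid is needed.
    obtain ⟨hk, hqk⟩ := Nat.find_spec hex
    have hlt := fun m => Nat.find_min hex (m := m)
    generalize Nat.find hex = k at hk hqk hlt
    refine ⟨gridPoint K β k, Finset.mem_image_of_mem _ (Finset.mem_range.2 (by omega)), hqk, ?_⟩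
    cases k with
    | zero =>
      have h0 : (Finset.univ.filter fun t => q ≤ β t ∧ β t < gridPoint K β 0) = ∅ :=
        Finset.filter_eq_empty_iff.2 fun t _ h => (hq.trans h.1).not_gt h.2
      rw [h0, Finset.card_empty, Nat.cast_zero]
      positivity
    | succ k =>
      have hkq : gridPoint K β k < q :=
        not_le.1 fun h => hlt k (Nat.lt_succ_self k) ⟨by omega, h⟩
      refine le_trans (Nat.cast_le.2 (Finset.card_le_card ?_))
        (countBetween_nextGridPoint_le hT₀ K β (gridPoint K β k))
      exact Finset.monotone_filter_right _ fun t _ h => ⟨hkq.trans_le h.1, h.2⟩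
  · left
    push Not at hex
    exact fun t => (le_gridPoint_self hK β t).trans_lt (hex K le_rfl)

end Grid

/-! ### Quantiles and concentration. -/

section Probability

/-- A quantile of level `c`. -/
theorem exists_le_measureReal_Iic (ν : Measure ℝ) [IsFiniteMeasure ν] {c : ℝ} (hc : 0 < c)
    (hν : c < ν.real Set.univ) :
    ∃ r, c ≤ ν.real (Set.Iic r) ∧ ∀ p, c < ν.real (Set.Iio p) → r < p := by
  let S : Set ℝ := {x | c ≤ ν.real (Set.Iic x)}
  have hne : S.Nonempty := by
    have h := (ENNReal.tendsto_toReal (measure_ne_top ν Set.univ)).comp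
      (tendsto_measure_Iic_atTop ν)
    obtain ⟨x, hx⟩ := (h.eventually (lt_mem_nhds hν)).exists
    exact ⟨x, le_of_lt hx⟩
  have hbdd : BddBelow S := by
    have h := tendsto_measure_iInter_atBot (μ := ν) (s := fun x : ℝ => Set.Iic x)
      (fun _ => measurableSet_Iic.nullMeasurableSet) (fun _ _ => Set.Iic_subset_Iic.2)
      ⟨0, measure_ne_top _ _⟩
    have hI : (⋂ x : ℝ, Set.Iic x) = ∅ := by
      simp only [Set.eq_empty_iff_forall_notMem, Set.mem_iInter, Set.mem_Iic, not_forall, not_le]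
      exact exists_lt
    rw [hI, measure_empty] at h
    replace h := (ENNReal.tendsto_toReal ENNReal.zero_ne_top).comp h
    obtain ⟨x, hx⟩ := (h.eventually (gt_mem_nhds hc)).exists
    refine ⟨x, fun y hy => not_lt.1 fun hyx => ?_⟩
    exact (hy.trans (measureReal_mono (Set.Iic_subset_Iic.2 hyx.le))).not_gt hx
  -- Continuity from above shows that the infimum itself has mass at least `c`. Continuity from
  -- below puts some `u m < p` in `S`, which makes `sInf S < p` strict.
  refine ⟨sInf S, ?_, fun p hp => ?_⟩
  · have h := tendsto_measure_biInter_gt (μ := ν) (s := fun x : ℝ => Set.Iic x) (a := sInf S)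
      (fun r _ => measurableSet_Iic.nullMeasurableSet) (fun i j _ hij => Set.Iic_subset_Iic.2 hij)
      ⟨sInf S + 1, by simp, measure_ne_top _ _⟩
    have hI : (⋂ r > sInf S, Set.Iic r) = Set.Iic (sInf S) := by
      ext x
      simp only [Set.mem_iInter, Set.mem_Iic]
      exact ⟨fun h => le_of_forall_gt_imp_ge_of_dense h, fun h r hr => h.trans (le_of_lt hr)⟩
    rw [hI] at h
    refine ge_of_tendsto ((ENNReal.tendsto_toReal (measure_ne_top ν _)).comp h) ?_
    filter_upwards [self_mem_nhdsWithin] with x hx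
    obtain ⟨y, hy, hyx⟩ := exists_lt_of_csInf_lt hne hx
    exact le_trans hy (measureReal_mono (Set.Iic_subset_Iic.2 hyx.le))
  · obtain ⟨u, hu, hup, hlim⟩ := exists_seq_strictMono_tendsto p
    have hU : (⋃ m, Set.Iic (u m)) = Set.Iio p := by
      ext x
      simp only [Set.mem_iUnion, Set.mem_Iic, Set.mem_Iio]
      refine ⟨fun ⟨m, hm⟩ => hm.trans_lt (hup m), fun hx => ?_⟩
      obtain ⟨m, hm⟩ := (hlim.eventually (lt_mem_nhds hx)).exists
      exact ⟨m, hm.le⟩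
    have h := tendsto_measure_iUnion_atTop (μ := ν) (s := fun m => Set.Iic (u m))
      fun i j hij => Set.Iic_subset_Iic.2 (hu.monotone hij)
    rw [hU] at h
    obtain ⟨m, hm⟩ := (((ENNReal.tendsto_toReal (measure_ne_top ν _)).comp h).eventually
      (lt_mem_nhds hp)).exists
    exact (csInf_le hbdd (show u m ∈ S from le_of_lt hm)).trans_lt (hup m)

/-- Hoeffding's inequality for the empirical frequency of an event. -/
theorem measureReal_card_le_le_exp {E Ω : Type*} [MeasurableSpace E] [MeasurableSpace Ω]
    {P : Measure E} [IsProbabilityMeasure P] {μ : Measure Ω} [IsProbabilityMeasure μ] {T : ℕ}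
    (hT : 1 ≤ T) {X : Fin T → Ω → E} (hlaw : ∀ t, HasLaw (X t) P μ) (hindep : iIndepFun X μ)
    {A : Set E} (hA : MeasurableSet A) [DecidablePred (· ∈ A)] {a ε : ℝ} (hε : 0 ≤ ε)
    (ha : a + ε ≤ P.real A) :
    μ.real {ω | ((Finset.univ.filter fun t => X t ω ∈ A).card : ℝ) ≤ (T : ℝ) * a}
      ≤ Real.exp (-(2 * (T : ℝ) * ε ^ 2)) := by
  -- This sign turns too few hits of `A` into an upper tail. The range has length `1`, so the
  -- sub-Gaussian parameter is `1/4`, giving the exponent `-2Tε²`.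
  let g : E → ℝ := fun x => P.real A - A.indicator 1 x
  have hg : Measurable g := measurable_const.sub (measurable_one.indicator hA)
  have hgI (x : E) : g x ∈ Set.Icc (P.real A - 1) (P.real A) := by
    by_cases hx : x ∈ A <;> simp [g, hx]
  have hg0 : ∫ x, g x ∂P = 0 := by
    have hi : Integrable (A.indicator (1 : E → ℝ)) P := (integrable_const (1 : ℝ)).indicator hA
    rw [integral_sub (integrable_const _) hi, integral_indicator_one hA]
    simp
  have hsub (t : Fin T) : HasSubgaussianMGF (g ∘ X t) ((‖P.real A - (P.real A - 1)‖₊ / 2) ^ 2) μ :=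
    hasSubgaussianMGF_of_mem_Icc_of_integral_eq_zero
      (hg.comp_aemeasurable (hlaw t).aemeasurable) (Eventually.of_forall fun ω => hgI _)
      (((hlaw t).integral_comp hg.aestronglyMeasurable).trans hg0)
  have hT' : (0 : ℝ) < T := by positivity
  have h := HasSubgaussianMGF.measure_sum_ge_le_of_iIndepFun (s := Finset.univ)
    (hindep.comp (fun _ => g) fun _ => hg) (fun t _ => hsub t) (mul_nonneg hT'.le hε)
  refine (measureReal_mono fun ω hω => ?_).trans (h.trans_eq ?_)
  · have hsum : ∑ t, (g ∘ X t) ω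
        = (T : ℝ) * P.real A - ((Finset.univ.filter fun t => X t ω ∈ A).card : ℝ) := by
      simp [g, Finset.sum_sub_distrib, Set.indicator_apply]
    simp only [Set.mem_ofPred_eq] at hω ⊢
    rw [hsum]
    nlinarith [mul_le_mul_of_nonneg_left ha hT'.le]
  · congr 1
    simp
    field_simp

/-- Subadditivity alone suffices, so the success event need not be shown measurable. -/
theorem one_sub_le_measureReal {Ω : Type*} [MeasurableSpace Ω] {μ : Measure Ω}
    [IsProbabilityMeasure μ] {A B : Set Ω} {δ : ℝ} (hB : μ.real B ≤ δ) (h : Aᶜ ⊆ B) :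
    1 - δ ≤ μ.real A := by
  have hAB : (1 : ℝ) ≤ μ.real A + μ.real B := by
    calc (1 : ℝ) = μ.real (A ∪ Aᶜ) := by rw [Set.union_compl_self, probReal_univ]
      _ ≤ μ.real A + μ.real Aᶜ := measureReal_union_le _ _
      _ ≤ μ.real A + μ.real B := by gcongr; exact measure_ne_top _ _
  linarith

end Probability

/-! ### From a bad grid to an undersampled interval. -/

section Main

variable {n T₀ K : ℕ} {P : Measure (Valuations n)}

theorem bestOnAdaptiveGrid_le_bestOnAugmentedGrid (β : Fin T₀ → ℝ) :
    bestOnAdaptiveGrid P K β ≤ bestOnAugmentedGrid P K β :=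
  Finset.sup'_mono _ Finset.subset_union_left _

/-- If the adaptive grid loses more than `c` against `q`, then few samples lie in a fixed interval
`[q, r]` that has probability at least `c`. -/
theorem exists_card_Icc_le [IsProbabilityMeasure P] (hn : 1 ≤ n)
    (hP : ∀ᵐ v ∂P, (∀ i, v.1 i ∈ Set.Icc (0 : ℝ) 1) ∧ v.2 ∈ Set.Icc (0 : ℝ) 1)
    (hT₀ : 1 ≤ T₀) (hK : 1 ≤ K) {q : ℝ} (hq : 0 ≤ q) {c : ℝ} (hc : 0 < c) :
    (∀ β : Fin T₀ → ℝ, expectedGFT P q - bestOnAdaptiveGrid P K β ≤ c) ∨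
      ∃ r, c ≤ P.real {v | highestBid v.1 ∈ Set.Icc q r} ∧
        ∀ β : Fin T₀ → ℝ, c < expectedGFT P q - bestOnAdaptiveGrid P K β →
          ((Finset.univ.filter fun t => β t ∈ Set.Icc q r).card : ℝ) ≤ (T₀ : ℝ) / (K : ℝ) := by
  have hb : Measurable fun v : Valuations n => highestBid v.1 :=
    measurable_highestBid.comp measurable_fst
  -- Restricting the law of the highest bid to `[q, ∞)` makes `ν (Iic r)` the probability of `[q,
  -- r]`.
  let ν : Measure ℝ := (P.map fun v => highestBid v.1).restrict (Set.Ici q)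
  have hν {s : Set ℝ} (hs : MeasurableSet s) :
      ν.real s = P.real {v | highestBid v.1 ∈ s ∩ Set.Ici q} := by
    rw [measureReal_restrict_apply hs, map_measureReal_apply hb (hs.inter measurableSet_Ici)]
    rfl
  have hle {β : Fin T₀ → ℝ} {p : ℝ} (hp : p ∈ adaptiveGrid K β) :
      expectedGFT P p ≤ bestOnAdaptiveGrid P K β := Finset.le_sup' _ hp
  have hIio (p : ℝ) : ν.real (Set.Iio p) = P.real {v | q ≤ highestBid v.1 ∧ highestBid v.1 < p} := by
    rw [hν measurableSet_Iio]
    congr 1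
    ext v
    exact and_comm
  have huniv : ν.real Set.univ = P.real {v | q ≤ highestBid v.1} := by
    rw [hν MeasurableSet.univ]
    simp
  have h0 (β : Fin T₀ → ℝ) : 0 ≤ bestOnAdaptiveGrid P K β := by
    obtain ⟨p, hp⟩ := adaptiveGrid_nonempty K β
    exact (expectedGFT_nonneg hn hP p).trans (hle hp)
  have hq₁ := expectedGFT_le_measureReal hn hP q
  by_cases hcν : c < ν.real Set.univ
  · right
    obtain ⟨r, hr, hrp⟩ := exists_le_measureReal_Iic ν hc hcν
    refine ⟨r, ?_, fun β hβ => ?_⟩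
    · rw [hν measurableSet_Iic, Set.inter_comm, Set.Ici_inter_Iic] at hr
      exact hr
    · rcases exists_adaptiveGrid_ge hT₀ hK β hq with h | ⟨p, hp, hqp, hcard⟩
      · have hemp : (Finset.univ.filter fun t => β t ∈ Set.Icc q r) = ∅ :=
          Finset.filter_eq_empty_iff.2 fun t _ ht => (h t).not_ge ht.1
        rw [hemp, Finset.card_empty, Nat.cast_zero]
        positivity
      -- A loss above `c` at the grid point `p` forces `[q, p)` to have probability above `c`.
      · have hlt : r < p := hrp p (by
          have := expectedGFT_le_add hn hP hqp
          rw [hIio]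
          linarith [hle hp])
        refine le_trans (Nat.cast_le.2 (Finset.card_le_card ?_)) hcard
        exact Finset.monotone_filter_right _ fun t _ h => ⟨h.1, h.2.trans_lt hlt⟩
  · left
    intro β
    rw [huniv] at hcν
    linarith [h0 β]

end Main


theorem mainTheorem4 {n : ℕ} (hn : 1 ≤ n)
    (P : MeasureTheory.Measure (Valuations n)) [MeasureTheory.IsProbabilityMeasure P]
    (hP : ∀ᵐ v ∂P, (∀ i, v.1 i ∈ Set.Icc (0 : ℝ) 1) ∧ v.2 ∈ Set.Icc (0 : ℝ) 1)
    (T₀ K : ℕ) (hT₀ : 1 ≤ T₀) (hK : 1 ≤ K) (δ : ℝ) (hδ : 0 < δ)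
    {Ω : Type*} [MeasurableSpace Ω] (μ : MeasureTheory.Measure Ω)
    [MeasureTheory.IsProbabilityMeasure μ]
    (X : Fin T₀ → Ω → Valuations n)
    (hlaw : ∀ t, ProbabilityTheory.HasLaw (X t) P μ)
    (hindep : ProbabilityTheory.iIndepFun X μ) :
    ∃ qStar ∈ Set.Icc (0 : ℝ) 1, IsMaxOn (expectedGFT P) (Set.Icc (0 : ℝ) 1) qStar ∧
      1 - δ ≤ μ.real {ω | expectedGFT P qStar
          - bestOnAdaptiveGrid P K (fun t => highestBid (X t ω).1)
          ≤ 1 / (K : ℝ) + Real.sqrt (Real.log (2 / δ) / (2 * (T₀ : ℝ)))} ∧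
      1 - δ ≤ μ.real {ω | expectedGFT P qStar
          - bestOnAugmentedGrid P K (fun t => highestBid (X t ω).1)
          ≤ 1 / (K : ℝ) + Real.sqrt (Real.log (2 / δ) / (2 * (T₀ : ℝ)))} := by
  obtain ⟨q, hq, hmax⟩ := exists_isMaxOn_expectedGFT hn hP
  have key : 1 - δ ≤ μ.real {ω | expectedGFT P q
      - bestOnAdaptiveGrid P K (fun t => highestBid (X t ω).1)
      ≤ 1 / (K : ℝ) + Real.sqrt (Real.log (2 / δ) / (2 * (T₀ : ℝ)))} := by
    rcases le_or_gt 1 δ with hδ₁ | hδ₁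
    · exact (sub_nonpos.2 hδ₁).trans measureReal_nonneg
    have hT₀' : (0 : ℝ) < T₀ := by positivity
    have hK' : (0 : ℝ) < K := by positivity
    -- Nonnegativity ensures that squaring `ε` recovers the quotient under the root, rather than the
    -- default `0`.
    have hlog : 0 ≤ Real.log (2 / δ) := Real.log_nonneg ((one_le_div hδ).2 (by linarith))
    set ε := Real.sqrt (Real.log (2 / δ) / (2 * (T₀ : ℝ))) with hε
    have hε₀ : 0 ≤ ε := Real.sqrt_nonneg _
    -- Only one tail is used, so the failure probability is `δ / 2`, half of what is allowed.
    have hexp : Real.exp (-(2 * (T₀ : ℝ) * ε ^ 2)) = δ / 2 := by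
      rw [hε, Real.sq_sqrt (by positivity), mul_div_cancel₀ _ (by positivity), Real.exp_neg,
        Real.exp_log (by positivity), inv_div]
    rcases exists_card_Icc_le hn hP hT₀ hK hq.1 (c := 1 / (K : ℝ) + ε) (by positivity) with
      h | ⟨r, hr, hbad⟩
    · refine one_sub_le_measureReal (B := ∅) (by simpa using hδ.le) fun ω hω => ?_
      exact hω (h _)
    · classical
      have hH := measureReal_card_le_le_exp hT₀ hlaw hindep
        (measurableSet_highestBid_mem (n := n) (measurableSet_Icc (a := q) (b := r))) hε₀ hr
      refine one_sub_le_measureReal (hH.trans (by rw [hexp]; linarith)) fun ω hω => ?_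
      have h := hbad _ (not_le.1 hω)
      rw [div_eq_mul_one_div] at h
      simpa only [Set.mem_ofPred_eq] using h
  refine ⟨q, hq, hmax, key, key.trans (measureReal_mono fun ω hω => ?_)⟩
  exact (sub_le_sub_left (bestOnAdaptiveGrid_le_bestOnAugmentedGrid _) _).trans hω
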